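/- For $n\ge 1$ let $\mathcal W=\mathcal W_n=\langle s_0,\dots,s_{n-1}\mid s_i^2=1,\ (s_is_j)^2=1 \text{ for } |i-j|\ge 2\rangle$ be the universal string Coxeter group of rank $n$. Put $H_i=\langle s_j\mid j\ne i\rangle$ for $0\le i\le n-1$ and $H_{-1}=H_n=\mathcal W$. For a subgroup $N\le\mathcal W$ let $\mathcal P(N)$ be the poset whose faces of rank $i$ $(-1\le i\le n)$ are the double cosets $H_i u N$, $u\in\mathcal W$ (faces of different ranks being regarded as different), ordered by $H_iuN\le H_jvN$ if and only if $i\le j$ and $H_iuN\cap H_jvN\neq\emptyset$. The group $N$ is called \emph{sparse} if $\mathcal P(N)$ is an abstract polytope of rank $n$, that is, it has a least and a greatest face, every flag (maximal chain) has exactly $n+2$ faces, every section $\{H\mid F\le H\le G\}$ with $F\le G$ is flag-connected (any two flags of it are joined by a finite sequence of flags in which consecutive ones differ in exactly one face), and whenever $F<G$ with $\operatorname{rank}G=\operatorname{rank}F+2$ there are exactly two faces $H$ with $F<H<G$. If $N$ is sparse, every flag $\Phi$ of $\mathcal P(N)$ has for each $0\le i\le n-1$ a unique $i$-adjacent flag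 $\Phi^i$, which differs from $\Phi$ exactly in the face of rank $i$, and $\mathcal W$ acts on the left on the set of flags by $s_i\Phi=\Phi^i$. A sparse group $N$ is called \emph{semisparse} if $N$ is precisely the stabilizer in $\mathcal W$ of the base flag $\{H_iN\mid -1\le i\le n\}$. \textbf{Theorem.} For every $n>3$ there is a subgroup $N\le\mathcal W_n$ that is sparse but not semisparse. -/

import Mathlib

/-! ### Abstract polytopes -/

namespace AbstractPolytope

variable {P : Type*} [PartialOrder P]

/-- Two flags (maximal chains) are adjacent when they differ in exactly one face. -/
def FlagAdjacent (Φ Ψ : Flag P) : Prop :=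
  ((Φ : Set P) \ (Ψ : Set P)).ncard = 1 ∧ ((Ψ : Set P) \ (Φ : Set P)).ncard = 1

/-- Any two flags are joined by a finite sequence of successively adjacent flags. -/
def FlagConnected (P : Type*) [PartialOrder P] : Prop :=
  ∀ Φ Ψ : Flag P, Relation.ReflTransGen FlagAdjacent Φ Ψ

/-- A partially ordered set `P` is an (abstract) polytope of rank `n`: it has a least and a greatest
face, every flag has exactly `n + 2` faces, it is strongly flag-connected (every section
`G / F = {H | F ≤ H ≤ G}` is flag-connected), and it satisfies the diamond condition.
The rank of a face `F` is `Order.height F - 1` (the least face has height `0` and rank `-1`). -/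
structure IsPolytope (n : ℕ) (P : Type*) [PartialOrder P] : Prop where
  exists_least : ∃ F : P, IsBot F
  exists_greatest : ∃ F : P, IsTop F
  flag_ncard : ∀ Φ : Flag P, (Φ : Set P).ncard = n + 2
  section_flagConnected : ∀ F G : P, F ≤ G → FlagConnected (Set.Icc F G)
  diamond : ∀ F G : P, F < G → Order.height G = Order.height F + 2 → (Set.Ioo F G).ncard = 2

end AbstractPolytope

/-! ### The universal string Coxeter group and its double coset posets -/

namespace StringCoxeter

/-- The Coxeter matrix of the linear diagram on `n` nodes with all edges labelled `∞`
(Mathlib encodes the label `∞` by `0`). -/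
def universalMatrix (n : ℕ) : CoxeterMatrix (Fin n) where
  M := Matrix.of fun i j : Fin n ↦
    if i = j then 1
      else (if (j : ℕ) + 1 = i ∨ (i : ℕ) + 1 = j then 0 else 2)
  isSymm := by unfold Matrix.IsSymm; aesop
  diagonal := by simp
  off_diagonal := by aesop

/-- The universal group of rank `n`:
`𝒲 = ⟨s₀, …, sₙ₋₁ ∣ sᵢ² = 1, (sᵢ sⱼ)² = 1 for |i - j| ≥ 2⟩`. -/
abbrev UniversalGroup (n : ℕ) : Type := (universalMatrix n).Group

/-- The generator `sᵢ` of the universal group. -/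
abbrev gen {n : ℕ} (i : Fin n) : UniversalGroup n := (universalMatrix n).simple i

theorem gen_mul_self {n : ℕ} (i : Fin n) : gen i * gen i = 1 :=
  (universalMatrix n).toCoxeterSystem.simple_mul_simple_self i

theorem gen_comm {n : ℕ} (i j : Fin n) (hij : (i : ℕ) + 1 < j) : gen i * gen j = gen j * gen i := by
  have h : (gen i * gen j) ^ ((universalMatrix n).M i j) = 1 :=
    (universalMatrix n).toCoxeterSystem.simple_mul_simple_pow i j
  have hM : (universalMatrix n).M i j = 2 := by
    simp only [universalMatrix, Matrix.of_apply]
    rw [if_neg (by rintro rfl; omega), if_neg (by omega)]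
  rw [hM, pow_two] at h
  have hi := gen_mul_self i
  have hj := gen_mul_self j
  rw [mul_eq_one_iff_eq_inv, mul_inv_rev, ← eq_inv_of_mul_eq_one_right hi,
    ← eq_inv_of_mul_eq_one_right hj] at h
  exact h

/-- Throughout, the ranks `-1, 0, …, n` are encoded by `r : Fin (n + 2)`, with `r` standing for the
rank `r - 1`. `faceGroup n r` is the subgroup `H_{r-1} = ⟨sⱼ ∣ j ≠ r - 1⟩`; for the improper ranks
`-1` and `n` it is the whole group. -/
def faceGroup (n : ℕ) (r : Fin (n + 2)) : Subgroup (UniversalGroup n) :=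
  Subgroup.closure {g | ∃ j : Fin n, (j : ℕ) + 1 ≠ r ∧ g = gen j}

theorem faceGroup_factor {n : ℕ} (r : Fin (n + 2)) {h : UniversalGroup n} (hh : h ∈ faceGroup n r) :
    ∃ a ∈ Subgroup.closure {g | ∃ j : Fin n, (j : ℕ) + 1 < r ∧ g = gen j},
      ∃ b ∈ Subgroup.closure {g | ∃ j : Fin n, (r : ℕ) < (j : ℕ) + 1 ∧ g = gen j}, h = a * b := by
  induction hh using Subgroup.closure_induction_left with
  | one => exact ⟨1, one_mem _, 1, one_mem _, by simp⟩
  | mul_left x hx y _ ih =>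
    obtain ⟨j, hj, rfl⟩ := hx
    obtain ⟨a, ha, b, hb, rfl⟩ := ih
    rcases lt_or_gt_of_ne hj with hj | hj
    · exact ⟨gen j * a, mul_mem (Subgroup.subset_closure ⟨j, hj, rfl⟩) ha, b, hb,
        (mul_assoc _ _ _).symm⟩
    · refine ⟨a, ha, gen j * b, mul_mem (Subgroup.subset_closure ⟨j, hj, rfl⟩) hb, ?_⟩
      have hle : Subgroup.closure {g | ∃ k : Fin n, (k : ℕ) + 1 < r ∧ g = gen k} ≤
          Subgroup.centralizer {gen j} := by
        rw [Subgroup.closure_le]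
        rintro _ ⟨k, hk, rfl⟩
        rw [SetLike.mem_coe, Subgroup.mem_centralizer_singleton_iff]
        exact gen_comm k j (by omega)
      have hc := Subgroup.mem_centralizer_singleton_iff.1 (hle ha)
      rw [← mul_assoc, ← mul_assoc, hc]
  | inv_mul_cancel x hx y _ ih =>
    obtain ⟨j, hj, rfl⟩ := hx
    obtain ⟨a, ha, b, hb, rfl⟩ := ih
    rw [← eq_inv_of_mul_eq_one_right (gen_mul_self j)]
    rcases lt_or_gt_of_ne hj with hj | hj
    · exact ⟨gen j * a, mul_mem (Subgroup.subset_closure ⟨j, hj, rfl⟩) ha, b, hb,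
        (mul_assoc _ _ _).symm⟩
    · refine ⟨a, ha, gen j * b, mul_mem (Subgroup.subset_closure ⟨j, hj, rfl⟩) hb, ?_⟩
      have hle : Subgroup.closure {g | ∃ k : Fin n, (k : ℕ) + 1 < r ∧ g = gen k} ≤
          Subgroup.centralizer {gen j} := by
        rw [Subgroup.closure_le]
        rintro _ ⟨k, hk, rfl⟩
        rw [SetLike.mem_coe, Subgroup.mem_centralizer_singleton_iff]
        exact gen_comm k j (by omega)
      have hc := Subgroup.mem_centralizer_singleton_iff.1 (hle ha)
      rw [← mul_assoc, ← mul_assoc, hc]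

/-- The faces of the double coset poset of `N`: a face of rank `r - 1` is a double coset
`H_{r-1} w N`. Faces of different ranks are different even if the double cosets agree as sets. -/
@[ext] structure Face {n : ℕ} (N : Subgroup (UniversalGroup n)) where
  rank : Fin (n + 2)
  carrier : Set (UniversalGroup n)
  exists_eq : ∃ w, carrier = DoubleCoset.doubleCoset w (faceGroup n rank) N

variable {n : ℕ} {N : Subgroup (UniversalGroup n)}

/-- The face `H_{r-1} w N`. -/
def Face.mk' (N : Subgroup (UniversalGroup n)) (r : Fin (n + 2)) (w : UniversalGroup n) : Face N :=
  ⟨r, DoubleCoset.doubleCoset w (faceGroup n r) N, w, rfl⟩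

theorem Face.eq_mk' {F : Face N} {w : UniversalGroup n} (hw : w ∈ F.carrier) :
    F = Face.mk' N F.rank w := by
  obtain ⟨v, hv⟩ := F.exists_eq
  have : F.carrier = DoubleCoset.doubleCoset w (faceGroup n F.rank) N := by
    rw [hv] at hw ⊢
    exact (DoubleCoset.doubleCoset_eq_of_mem hw).symm
  exact Face.ext (y := Face.mk' N F.rank w) rfl this

theorem Face.mem_mk' (r : Fin (n + 2)) (w : UniversalGroup n) : w ∈ (Face.mk' N r w).carrier :=
  DoubleCoset.mem_doubleCoset_self _ _ _

/-- `H_i u N ≤ H_j v N` iff `i ≤ j` and the two double cosets intersect. -/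
instance : LE (Face N) where
  le F G := F.rank ≤ G.rank ∧ (F.carrier ∩ G.carrier).Nonempty

theorem Face.le_def {F G : Face N} :
    F ≤ G ↔ F.rank ≤ G.rank ∧ (F.carrier ∩ G.carrier).Nonempty := Iff.rfl

theorem Face.eq_of_inter {F G : Face N} (h : F.rank = G.rank)
    (hFG : (F.carrier ∩ G.carrier).Nonempty) : F = G := by
  obtain ⟨w, hF, hG⟩ := hFG
  rw [Face.eq_mk' hF, Face.eq_mk' hG, h]

instance : PartialOrder (Face N) where
  le_refl F := by
    obtain ⟨w, hw⟩ := F.exists_eq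
    exact ⟨le_rfl, w, by rw [hw, Set.inter_self]; exact DoubleCoset.mem_doubleCoset_self _ _ _⟩
  le_antisymm F G h h' := Face.eq_of_inter (le_antisymm h.1 h'.1) h.2
  le_trans F G K hFG hGK := by
    rcases hFG.1.eq_or_lt with h1 | h1
    · rwa [Face.eq_of_inter h1 hFG.2]
    rcases hGK.1.eq_or_lt with h2 | h2
    · rwa [← Face.eq_of_inter h2 hGK.2]
    refine ⟨hFG.1.trans hGK.1, ?_⟩
    obtain ⟨x, hxF, hxG⟩ := hFG.2
    obtain ⟨y, hyG, hyK⟩ := hGK.2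
    rw [Face.eq_mk' hxG] at hyG
    obtain ⟨h, hh, m, hm, rfl⟩ := DoubleCoset.mem_doubleCoset.1 hyG
    obtain ⟨a, ha, b, hb, rfl⟩ := faceGroup_factor _ hh
    have hb' : b ∈ faceGroup n F.rank := by
      refine Subgroup.closure_mono ?_ hb
      rintro _ ⟨j, hj, rfl⟩
      exact ⟨j, by have : (F.rank : ℕ) < G.rank := h1; omega, rfl⟩
    have ha' : a ∈ faceGroup n K.rank := by
      refine Subgroup.closure_mono ?_ ha
      rintro _ ⟨j, hj, rfl⟩
      exact ⟨j, by have : (G.rank : ℕ) < K.rank := h2; omega, rfl⟩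
    refine ⟨b * x * m, ?_, ?_⟩
    · rw [Face.eq_mk' hxF]
      exact DoubleCoset.mem_doubleCoset.2 ⟨b, hb', m, hm, rfl⟩
    · rw [Face.eq_mk' hyK]
      exact DoubleCoset.mem_doubleCoset.2 ⟨a⁻¹, inv_mem ha', 1, one_mem _, by group⟩

theorem Face.rank_lt {F G : Face N} (h : F < G) : F.rank < G.rank :=
  lt_of_le_of_ne h.le.1 fun e => h.ne (Face.eq_of_inter e h.le.2)

theorem Face.mk'_le (w : UniversalGroup n) {r t : Fin (n + 2)} (h : r ≤ t) :
    Face.mk' N r w ≤ Face.mk' N t w :=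
  ⟨h, w, Face.mem_mk' _ _, Face.mem_mk' _ _⟩

theorem Face.mk'_lt (w : UniversalGroup n) {r t : Fin (n + 2)} (h : r < t) :
    Face.mk' N r w < Face.mk' N t w :=
  lt_of_le_of_ne (Face.mk'_le w h.le) fun e => h.ne (congrArg Face.rank e)

theorem Face.height_eq (F : Face N) : Order.height F = ((F.rank : ℕ) : ℕ∞) := by
  apply le_antisymm
  · have := Order.height_le_height_apply_of_strictMono (fun F : Face N => (F.rank : ℕ))
      (fun _ _ h => Face.rank_lt h) F
    simpa using this
  · obtain ⟨w, hw⟩ := F.exists_eq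
    have key : ∀ k : ℕ, ∀ hk : k < n + 2, (k : ℕ∞) ≤ Order.height (Face.mk' N ⟨k, hk⟩ w) := by
      intro k
      induction k with
      | zero => simp
      | succ k ih =>
        intro hk
        have h1 := Order.height_add_one_le
          (Face.mk'_lt (N := N) w (r := ⟨k, by omega⟩) (t := ⟨k + 1, hk⟩) (by simp [Fin.lt_def]))
        refine le_trans ?_ h1
        push_cast
        gcongr
        exact ih _
    have := key F.rank F.rank.2
    rwa [show F = Face.mk' N ⟨F.rank, F.rank.2⟩ w from
      Face.ext (y := Face.mk' N F.rank w) rfl hw]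

/-- `N` is sparse if its double coset poset is an abstract polytope of rank `n`. -/
def Sparse (N : Subgroup (UniversalGroup n)) : Prop :=
  AbstractPolytope.IsPolytope n (Face N)

/-- A chain that contains a face of every rank is maximal. -/
def flagOfRanks (s : Set (Face N)) (hs : IsChain (· ≤ ·) s) (h : ∀ r, ∃ F ∈ s, F.rank = r) :
    Flag (Face N) where
  carrier := s
  Chain' := hs
  max_chain' t ht hst := by
    refine Set.Subset.antisymm hst fun F hF => ?_
    obtain ⟨G, hG, hr⟩ := h F.rank
    rcases ht.total hF (hst hG) with hle | hle
    · rwa [Face.eq_of_inter hr.symm hle.2]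
    · rwa [← Face.eq_of_inter hr hle.2]

/-- The base flag `{H_i N ∣ -1 ≤ i ≤ n}`. -/
def baseFlag (N : Subgroup (UniversalGroup n)) : Flag (Face N) :=
  flagOfRanks (Set.range fun r => Face.mk' N r 1)
    (by
      rintro _ ⟨r, rfl⟩ _ ⟨t, rfl⟩ _
      exact (le_total r t).imp (Face.mk'_le 1) (Face.mk'_le 1))
    fun r => ⟨_, ⟨r, rfl⟩, rfl⟩

/-- Two flags are `i`-adjacent if they are different but have the same `j`-face for all `j ≠ i`. -/
def IsAdj (i : Fin n) (Φ Ψ : Flag (Face N)) : Prop :=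
  Φ ≠ Ψ ∧ ∀ F : Face N, (F.rank : ℕ) ≠ (i : ℕ) + 1 → (F ∈ Φ ↔ F ∈ Ψ)

theorem IsAdj.symm {i : Fin n} {Φ Ψ : Flag (Face N)} (h : IsAdj i Φ Ψ) : IsAdj i Ψ Φ :=
  ⟨h.1.symm, fun F hF => (h.2 F hF).symm⟩

theorem eq_of_mem_of_rank {Φ : Flag (Face N)} {F G : Face N} (hF : F ∈ Φ) (hG : G ∈ Φ)
    (h : F.rank = G.rank) : F = G := by
  rcases Φ.le_or_le hF hG with hle | hle
  · exact Face.eq_of_inter h hle.2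
  · exact (Face.eq_of_inter h.symm hle.2).symm

theorem lt_of_mem_of_rank {Φ : Flag (Face N)} {F G : Face N} (hF : F ∈ Φ) (hG : G ∈ Φ)
    (h : (F.rank : ℕ) < G.rank) : F < G := by
  rcases Φ.le_or_le hF hG with hle | hle
  · exact lt_of_le_of_ne hle (by rintro rfl; omega)
  · exact absurd (show (G.rank : ℕ) ≤ F.rank from hle.1) (by omega)

theorem flag_eq_of_subset {Φ Ψ : Flag (Face N)} (h : ∀ F ∈ Φ, F ∈ Ψ) : Φ = Ψ :=
  Flag.ext (Φ.max_chain' Ψ.Chain' h)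

theorem Sparse.exists_rank (hN : Sparse N) (Φ : Flag (Face N)) (r : Fin (n + 2)) :
    ∃ F ∈ Φ, F.rank = r := by
  have hinj : Set.InjOn Face.rank (Φ : Set (Face N)) :=
    fun F hF G hG h => eq_of_mem_of_rank hF hG h
  have hcard : (Face.rank '' (Φ : Set (Face N))).ncard = n + 2 := by
    rw [hinj.ncard_image, hN.flag_ncard]
  have huniv : Face.rank '' (Φ : Set (Face N)) = Set.univ := by
    rw [Set.eq_univ_iff_ncard, hcard, Nat.card_eq_fintype_card, Fintype.card_fin]
  obtain ⟨F, hF, h⟩ := huniv.ge (Set.mem_univ r)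
  exact ⟨F, hF, h⟩

theorem Sparse.diamond_pair (hN : Sparse N) {a b : Face N} (hab : a < b)
    (hr : (b.rank : ℕ) = a.rank + 2) : (Set.Ioo a b).ncard = 2 := by
  refine AbstractPolytope.IsPolytope.diamond hN a b hab ?_
  rw [Face.height_eq, Face.height_eq, hr]
  push_cast
  rfl

/-- In a pair with exactly two elements, two elements different from a third one agree. -/
theorem Sparse.diamond_unique (hN : Sparse N) {a b x y z : Face N} (hab : a < b)
    (hr : (b.rank : ℕ) = a.rank + 2) (hx : x ∈ Set.Ioo a b) (hy : y ∈ Set.Ioo a b)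
    (hz : z ∈ Set.Ioo a b) (hyx : y ≠ x) (hzx : z ≠ x) : y = z := by
  obtain ⟨p, q, _, h⟩ := Set.ncard_eq_two.1 (hN.diamond_pair hab hr)
  rw [h] at hx hy hz
  simp only [Set.mem_insert_iff, Set.mem_singleton_iff] at hx hy hz
  grind

/-- The face that changes under an `i`-adjacency is the second face in a section of rank one. -/
theorem IsAdj.mem_Ioo {i : Fin n} {Φ Ψ : Flag (Face N)} (h : IsAdj i Φ Ψ) {a b x y : Face N}
    (ha : a ∈ Φ) (har : (a.rank : ℕ) = i) (hb : b ∈ Φ) (hbr : (b.rank : ℕ) = i + 2)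
    (hx : x ∈ Φ) (hxr : (x.rank : ℕ) = i + 1) (hy : y ∈ Ψ) (hyr : (y.rank : ℕ) = i + 1) :
    x ∈ Set.Ioo a b ∧ y ∈ Set.Ioo a b ∧ y ≠ x := by
  refine ⟨⟨lt_of_mem_of_rank ha hx (by omega), lt_of_mem_of_rank hx hb (by omega)⟩,
    ⟨lt_of_mem_of_rank ((h.2 a (by omega)).1 ha) hy (by omega),
      lt_of_mem_of_rank hy ((h.2 b (by omega)).1 hb) (by omega)⟩, ?_⟩
  rintro rfl
  refine h.1 (flag_eq_of_subset fun F hF => ?_)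
  by_cases hF' : (F.rank : ℕ) = i + 1
  · rwa [eq_of_mem_of_rank hF hx (Fin.ext (by omega))]
  · exact (h.2 F hF').1 hF

/-- Local uniqueness: the new `i`-face of the `i`-adjacent flag depends only on the faces of ranks
`i - 1`, `i` and `i + 1`. -/
theorem Sparse.adj_face_eq (hN : Sparse N) {i : Fin n} {Φ Φ' Ψ Ψ' : Flag (Face N)}
    (hΦ : IsAdj i Φ Φ') (hΨ : IsAdj i Ψ Ψ')
    (h : ∀ F : Face N, (i : ℕ) ≤ F.rank → (F.rank : ℕ) ≤ i + 2 → F ∈ Φ → F ∈ Ψ) {y z : Face N}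
    (hy : y ∈ Φ') (hyr : (y.rank : ℕ) = i + 1) (hz : z ∈ Ψ') (hzr : (z.rank : ℕ) = i + 1) :
    y = z := by
  obtain ⟨a, ha, har⟩ := hN.exists_rank Φ ⟨i, by omega⟩
  obtain ⟨x, hx, hxr⟩ := hN.exists_rank Φ ⟨i + 1, by omega⟩
  obtain ⟨b, hb, hbr⟩ := hN.exists_rank Φ ⟨i + 2, by omega⟩
  replace har : (a.rank : ℕ) = i := by rw [har]
  replace hxr : (x.rank : ℕ) = i + 1 := by rw [hxr]
  replace hbr : (b.rank : ℕ) = i + 2 := by rw [hbr]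
  obtain ⟨h1, h2, h3⟩ := hΦ.mem_Ioo ha har hb hbr hx hxr hy hyr
  obtain ⟨_, h5, h6⟩ := hΨ.mem_Ioo (h a (by omega) (by omega) ha) har
    (h b (by omega) (by omega) hb) hbr (h x (by omega) (by omega) hx) hxr hz hzr
  exact hN.diamond_unique (lt_of_mem_of_rank ha hb (by omega)) (by omega) h1 h2 h5 h3 h6

/-- In a polytope every flag has exactly one `i`-adjacent flag. -/
theorem Sparse.existsUnique_adj (hN : Sparse N) (i : Fin n) (Φ : Flag (Face N)) :
    ∃! Ψ, IsAdj i Φ Ψ := by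
  refine existsUnique_of_exists_of_unique ?_ ?_
  · obtain ⟨a, ha, har⟩ := hN.exists_rank Φ ⟨i, by omega⟩
    obtain ⟨x, hx, hxr⟩ := hN.exists_rank Φ ⟨i + 1, by omega⟩
    obtain ⟨b, hb, hbr⟩ := hN.exists_rank Φ ⟨i + 2, by omega⟩
    replace har : (a.rank : ℕ) = i := by rw [har]
    replace hxr : (x.rank : ℕ) = i + 1 := by rw [hxr]
    replace hbr : (b.rank : ℕ) = i + 2 := by rw [hbr]
    have hab : a < b := lt_of_mem_of_rank ha hb (by omega)
    obtain ⟨y, hy, hyx⟩ := Set.exists_ne_of_one_lt_ncard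
      (by rw [hN.diamond_pair hab (by omega)]; norm_num) x
    have hyr : (y.rank : ℕ) = i + 1 := by
      have h1 : (a.rank : ℕ) < y.rank := Face.rank_lt hy.1
      have h2 : (y.rank : ℕ) < b.rank := Face.rank_lt hy.2
      omega
    have hcomp : ∀ F ∈ Φ, (F.rank : ℕ) ≠ i + 1 → F ≤ y ∨ y ≤ F := by
      intro F hF hne
      rcases lt_or_gt_of_ne hne with hlt | hlt
      · left
        refine le_trans ?_ hy.1.le
        rcases (show (F.rank : ℕ) ≤ a.rank by omega).eq_or_lt with e | e
        · exact (eq_of_mem_of_rank hF ha (Fin.ext e)).le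
        · exact (lt_of_mem_of_rank hF ha e).le
      · right
        refine le_trans hy.2.le ?_
        rcases (show (b.rank : ℕ) ≤ F.rank by omega).eq_or_lt with e | e
        · exact (eq_of_mem_of_rank hb hF (Fin.ext e)).le
        · exact (lt_of_mem_of_rank hb hF e).le
    refine ⟨flagOfRanks (insert y {F | F ∈ Φ ∧ (F.rank : ℕ) ≠ i + 1}) ?_ ?_, ?_, ?_⟩
    · refine IsChain.insert (Φ.chain_le.mono fun F hF => hF.1) ?_
      rintro F ⟨hF, hne⟩ _
      exact (hcomp F hF hne).symm
    · intro r
      by_cases hr : (r : ℕ) = i + 1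
      · exact ⟨y, Set.mem_insert _ _, Fin.ext (by omega)⟩
      · obtain ⟨F, hF, hFr⟩ := hN.exists_rank Φ r
        exact ⟨F, Set.mem_insert_of_mem _ ⟨hF, by rw [hFr]; exact hr⟩, hFr⟩
    · intro e
      have : y ∈ Φ := by
        rw [e]
        exact Set.mem_insert _ _
      exact hyx (eq_of_mem_of_rank this hx (Fin.ext (by omega)))
    · intro F hF
      constructor
      · intro h
        exact Set.mem_insert_of_mem _ ⟨h, hF⟩
      · intro h
        rcases Set.mem_insert_iff.1 h with h | h
        · exact absurd (h ▸ hyr) hF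
        · exact h.1
  · intro Ψ Ψ' h h'
    refine flag_eq_of_subset fun F hF => ?_
    by_cases hr : (F.rank : ℕ) = i + 1
    · obtain ⟨z, hz, hzr⟩ := hN.exists_rank Ψ' ⟨i + 1, by omega⟩
      rwa [hN.adj_face_eq h h' (fun _ _ _ h => h) hF hr hz (by rw [hzr])]
    · exact (h'.2 F hr).1 ((h.2 F hr).2 hF)

/-- The `i`-adjacent flag `Φⁱ` of the flag `Φ` of a polytope. -/
noncomputable def Sparse.adj (hN : Sparse N) (i : Fin n) (Φ : Flag (Face N)) : Flag (Face N) :=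
  (hN.existsUnique_adj i Φ).choose

theorem Sparse.isAdj_adj (hN : Sparse N) (i : Fin n) (Φ : Flag (Face N)) :
    IsAdj i Φ (hN.adj i Φ) :=
  (hN.existsUnique_adj i Φ).choose_spec.1

theorem Sparse.eq_adj (hN : Sparse N) {i : Fin n} {Φ Ψ : Flag (Face N)} (h : IsAdj i Φ Ψ) :
    Ψ = hN.adj i Φ :=
  (hN.existsUnique_adj i Φ).unique h (hN.isAdj_adj i Φ)

theorem Sparse.adj_adj (hN : Sparse N) (i : Fin n) (Φ : Flag (Face N)) :
    hN.adj i (hN.adj i Φ) = Φ :=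
  (hN.eq_adj (hN.isAdj_adj i Φ).symm).symm

theorem Sparse.adj_comm (hN : Sparse N) (i j : Fin n)
    (hij : (i : ℕ) + 1 < j ∨ (j : ℕ) + 1 < i) (Φ : Flag (Face N)) :
    hN.adj i (hN.adj j Φ) = hN.adj j (hN.adj i Φ) := by
  have h1 := hN.isAdj_adj i Φ
  have h2 := hN.isAdj_adj j Φ
  have h3 := hN.isAdj_adj i (hN.adj j Φ)
  refine hN.eq_adj ⟨fun e => ?_, fun F hF => ?_⟩
  · rw [e] at h1
    refine h2.1 (flag_eq_of_subset fun F hF => ?_)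
    by_cases hr : (F.rank : ℕ) = i + 1
    · exact (h2.2 F (by omega)).1 hF
    · exact (h3.2 F hr).2 ((h1.2 F hr).1 hF)
  · by_cases hr : (F.rank : ℕ) = i + 1
    · have hloc : ∀ G : Face N, (i : ℕ) ≤ G.rank → (G.rank : ℕ) ≤ i + 2 →
          G ∈ Φ → G ∈ hN.adj j Φ := fun G _ _ hG => (h2.2 G (by omega)).1 hG
      obtain ⟨y, hy, hyr⟩ := hN.exists_rank (hN.adj i Φ) ⟨i + 1, by omega⟩
      obtain ⟨z, hz, hzr⟩ := hN.exists_rank (hN.adj i (hN.adj j Φ)) ⟨i + 1, by omega⟩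
      have hyz := hN.adj_face_eq h1 h3 hloc hy (by rw [hyr]) hz (by rw [hzr])
      constructor
      · intro h
        rwa [eq_of_mem_of_rank h hy (Fin.ext (by rw [hr, hyr])), hyz]
      · intro h
        rwa [eq_of_mem_of_rank h hz (Fin.ext (by rw [hr, hzr])), ← hyz]
    · rw [← h1.2 F hr, ← h3.2 F hr, h2.2 F hF]

/-- The permutation `Φ ↦ Φⁱ` of the flags. -/
noncomputable def Sparse.adjPerm (hN : Sparse N) (i : Fin n) : Equiv.Perm (Flag (Face N)) where
  toFun := hN.adj i
  invFun := hN.adj i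
  left_inv := hN.adj_adj i
  right_inv := hN.adj_adj i

theorem Sparse.adjPerm_apply (hN : Sparse N) (i : Fin n) (Φ : Flag (Face N)) :
    hN.adjPerm i Φ = hN.adj i Φ := rfl

theorem Sparse.adjPerm_liftable (hN : Sparse N) :
    (universalMatrix n).IsLiftable hN.adjPerm := by
  intro i j
  simp only [universalMatrix, Matrix.of_apply]
  split_ifs with h1 h2
  · subst h1
    ext1 Φ
    simp [Sparse.adjPerm_apply, hN.adj_adj]
  · simp
  · have hij : (i : ℕ) + 1 < j ∨ (j : ℕ) + 1 < i := by
      have : (i : ℕ) ≠ j := fun e => h1 (Fin.ext e)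
      omega
    ext1 Φ
    simp only [pow_two, Equiv.Perm.mul_apply, Equiv.Perm.one_apply, Sparse.adjPerm_apply]
    rw [hN.adj_comm j i hij.symm, hN.adj_adj, hN.adj_adj]

/-- The flag action of the universal group on the flags of the polytope of a sparse group, that is,
the left action with `sᵢ Φ = Φⁱ`. -/
noncomputable def Sparse.flagAction (hN : Sparse N) :
    UniversalGroup n →* Equiv.Perm (Flag (Face N)) :=
  (universalMatrix n).toCoxeterSystem.lift ⟨hN.adjPerm, hN.adjPerm_liftable⟩

/-- The stabilizer of the base flag under the flag action. -/
noncomputable def Sparse.baseFlagStabilizer (hN : Sparse N) : Subgroup (UniversalGroup n) :=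
  (MulAction.stabilizer (Equiv.Perm (Flag (Face N))) (baseFlag N)).comap hN.flagAction

theorem Sparse.flagAction_gen (hN : Sparse N) (i : Fin n) (Φ : Flag (Face N)) :
    hN.flagAction (gen i) Φ = hN.adj i Φ := by
  have h : hN.flagAction (gen i) = hN.adjPerm i :=
    (universalMatrix n).toCoxeterSystem.lift_apply_simple hN.adjPerm_liftable i
  rw [h]
  rfl

/-- `N` is semisparse if it is sparse and is precisely the stabilizer of the base flag of its
polytope. -/
def Semisparse (N : Subgroup (UniversalGroup n)) : Prop :=
  ∃ hN : Sparse N, hN.baseFlagStabilizer = N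

end StringCoxeter

/-!
The witness comes from the `n`-polytope of Schläfli type `{2, …, 2}`, which has exactly two faces of
each proper rank, any two faces of different ranks being incident. Its flags are the vectors
`x : Fin n → ZMod 2`, and `sᵢ` flips the coordinate `i`. The universal group also acts on the
double cover `(Fin n → ZMod 2) × ZMod 2` of this set of flags, where a step along `s₁` adds `x₀`
to the last coordinate and a step along `s₃` adds `x₂` (`CoverPoint.step`, `coverAction`). Both
`(s₀ s₁)²` and `(s₂ s₃)²` then interchange the two sheets. Let `N` be the stabilizer of a point of
the cover (`coverStabilizer`).

Every group `H_i` contains `s₀, s₁` or `s₂, s₃`, hence an element that interchanges the sheets, so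
its orbits on the cover are the full preimages of its orbits on the flags of `{2, …, 2}`
(`exists_faceGroup_coverAction_eq`). Therefore `N` has the same double cosets as the stabilizer of
a flag of `{2, …, 2}`, its poset is that polytope (`Face.lt_iff_rank_lt`, `mk'_eq_mk'_iff`), and
`N` is sparse (`sparse_coverStabilizer`). The element `(s₀ s₁)²` fixes every flag of the polytope
but is not in `N`, so that `N` is not semisparse. The construction uses four generators because
of the two disjoint pairs: omitting one generator always leaves one of the pairs intact.
-/

/-! ### Weakly ordered posets -/

namespace AbstractPolytope

section WeakOrder

variable {Q ι : Type*} [PartialOrder Q] [LinearOrder ι] {ρ : Q → ι}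

/-- If elements are comparable as soon as their ranks differ, a maximal chain meets every rank
that occurs. -/
theorem exists_mem_flag_rank_eq (hρ : ∀ a b : Q, a < b ↔ ρ a < ρ b) (Φ : Flag Q) (y : Q) :
    ∃ x ∈ Φ, ρ x = ρ y := by
  by_contra! hne
  have hchain : IsChain (· ≤ ·) (insert y (Φ : Set Q)) := by
    refine Φ.chain_le.insert fun b hb _ => ?_
    rcases lt_or_gt_of_ne (hne b hb) with h | h
    · exact Or.inr ((hρ _ _).2 h).le
    · exact Or.inl ((hρ _ _).2 h).le
  have heq := Φ.max_chain' hchain (Set.subset_insert _ _)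
  have hy : y ∈ (Φ : Set Q) := by
    change y ∈ Φ.carrier
    rw [heq]
    exact Set.mem_insert _ _
  exact hne y hy rfl

theorem injOn_rank_flag (hρ : ∀ a b : Q, a < b ↔ ρ a < ρ b) (Φ : Flag Q) :
    Set.InjOn ρ (Φ : Set Q) := by
  intro a ha b hb hab
  by_contra hne
  rcases Φ.le_or_le ha hb with h | h
  · exact ((hρ _ _).1 (lt_of_le_of_ne h hne)).ne hab
  · exact ((hρ _ _).1 (lt_of_le_of_ne h (Ne.symm hne))).ne hab.symm

/-- The flag obtained from `Φ` by exchanging its face `x` for a face `y` of the same rank. -/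
def exchangeFlag (hρ : ∀ a b : Q, a < b ↔ ρ a < ρ b) (Φ : Flag Q) (x y : Q)
    (hx : x ∈ Φ) (hxy : ρ x = ρ y) : Flag Q where
  carrier := insert y ((Φ : Set Q) \ {x})
  Chain' := by
    refine (Φ.chain_le.mono Set.sdiff_subset).insert ?_
    rintro b ⟨hb, hbx⟩ _
    rcases lt_trichotomy (ρ b) (ρ y) with h | h | h
    · exact Or.inr ((hρ _ _).2 h).le
    · exact absurd (injOn_rank_flag hρ Φ hb hx (h.trans hxy.symm)) hbx
    · exact Or.inl ((hρ _ _).2 h).le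
  max_chain' t ht hst := by
    refine Set.Subset.antisymm hst fun F hF => ?_
    have hrep : ∃ G ∈ insert y ((Φ : Set Q) \ {x}), ρ G = ρ F := by
      obtain ⟨G, hG, hGF⟩ := exists_mem_flag_rank_eq hρ Φ F
      by_cases hGx : G = x
      · exact ⟨y, Set.mem_insert _ _, by rw [← hxy, ← hGx, hGF]⟩
      · exact ⟨G, Set.mem_insert_of_mem _ ⟨hG, hGx⟩, hGF⟩
    obtain ⟨G, hG, hGF⟩ := hrep
    by_cases hne : G = F
    · rwa [← hne]
    · rcases ht.total (hst hG) hF with h | h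
      · exact absurd hGF ((hρ _ _).1 (lt_of_le_of_ne h hne)).ne
      · exact absurd hGF.symm ((hρ _ _).1 (lt_of_le_of_ne h (Ne.symm hne))).ne

/-- Two flags of a weakly ordered poset are joined by exchanging their differing faces one at a
time. -/
theorem flagConnected_of_lt_iff_rank_lt [Finite ι] (hρ : ∀ a b : Q, a < b ↔ ρ a < ρ b) :
    FlagConnected Q := by
  have hfin : ∀ Φ : Flag Q, (Φ : Set Q).Finite := fun Φ =>
    Set.Finite.of_finite_image (Set.toFinite _) (injOn_rank_flag hρ Φ)
  intro Φ Ψ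
  induction hk : ((Φ : Set Q) \ Ψ).ncard using Nat.strong_induction_on generalizing Φ with
  | _ k ih =>
    by_cases hsub : (Φ : Set Q) ⊆ Ψ
    · rw [show Φ = Ψ from Flag.ext (Φ.max_chain' Ψ.Chain' hsub)]
    · obtain ⟨x, hx, hxΨ⟩ := Set.not_subset.1 hsub
      obtain ⟨y, hy, hyx⟩ := exists_mem_flag_rank_eq hρ Ψ x
      have hyΦ : y ∉ (Φ : Set Q) := fun h => hxΨ (injOn_rank_flag hρ Φ h hx hyx ▸ hy)
      have hne : x ≠ y := fun h => hxΨ (h ▸ hy)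
      have hcar : (exchangeFlag hρ Φ x y hx hyx.symm : Set Q) = insert y ((Φ : Set Q) \ {x}) := rfl
      have hadj : FlagAdjacent Φ (exchangeFlag hρ Φ x y hx hyx.symm) := by
        constructor
        · rw [Set.ncard_eq_one]
          refine ⟨x, ?_⟩
          rw [hcar]
          ext a
          simp only [Set.mem_sdiff, Set.mem_insert_iff, Set.mem_singleton_iff]
          grind
        · rw [Set.ncard_eq_one]
          refine ⟨y, ?_⟩
          rw [hcar]
          ext a
          simp only [Set.mem_sdiff, Set.mem_insert_iff, Set.mem_singleton_iff]
          grind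
      refine Relation.ReflTransGen.head hadj (ih _ ?_ _ rfl)
      rw [← hk]
      refine Set.ncard_lt_ncard ⟨?_, fun h => ?_⟩ ((hfin Φ).subset Set.sdiff_subset)
      · rintro a ⟨ha, haΨ⟩
        rw [hcar] at ha
        rcases ha with rfl | ha
        · exact absurd hy haΨ
        · exact ⟨ha.1, haΨ⟩
      · have h1 := (h ⟨hx, hxΨ⟩).1
        rw [hcar] at h1
        rcases h1 with h1 | h1
        · exact hne h1
        · exact h1.2 rfl

end WeakOrder

end AbstractPolytope

/-! ### The double cover of the flags of `{2, …, 2}` -/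

namespace StringCoxeter

/-- The points of the double cover: a flag of `{2, …, 2}`, given by the choice of one of the two
faces of each proper rank, together with a sheet. -/
abbrev CoverPoint (m : ℕ) : Type := (Fin (m + 4) → ZMod 2) × ZMod 2

/-- The change of sheet along the step `sᵢ` from the flag `x`. -/
def sheetChange {m : ℕ} (i : Fin (m + 4)) (x : Fin (m + 4) → ZMod 2) : ZMod 2 :=
  if (i : ℕ) = 1 then x 0 else if (i : ℕ) = 3 then x 2 else 0

/-- The step from a point of the double cover to its `i`-adjacent one. -/
def CoverPoint.step {m : ℕ} (i : Fin (m + 4)) (p : CoverPoint m) : CoverPoint m :=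
  (p.1 + Pi.single i 1, p.2 + sheetChange i p.1)

theorem val_two_fin_add_four (m : ℕ) : ((2 : Fin (m + 4)) : ℕ) = 2 := rfl

/-- A step `sⱼ` with `j ≠ i - 1` does not affect the sheet change of `sᵢ`. Hence the steps are
involutions, and `sᵢ` and `sⱼ` commute if `|i - j| ≥ 2`. -/
theorem sheetChange_add_single {m : ℕ} {i j : Fin (m + 4)}
    (h : (j : ℕ) + 1 ≠ i) (x : Fin (m + 4) → ZMod 2) :
    sheetChange i (x + Pi.single j 1) = sheetChange i x := by
  have h2 := val_two_fin_add_four m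
  unfold sheetChange
  split_ifs with h1 h3
  · have : (0 : Fin (m + 4)) ≠ j := by
      rintro rfl
      simp at h
      omega
    simp [this]
  · have : (2 : Fin (m + 4)) ≠ j := by
      rintro rfl
      omega
    simp [this]
  · rfl

theorem CoverPoint.step_step {m : ℕ} (i : Fin (m + 4)) (p : CoverPoint m) :
    CoverPoint.step i (CoverPoint.step i p) = p := by
  have h : sheetChange i (p.1 + Pi.single i 1) = sheetChange i p.1 :=
    sheetChange_add_single (by omega) _
  ext1
  · simp only [CoverPoint.step, add_assoc]
    rw [← Pi.single_add, CharTwo.add_self_eq_zero, Pi.single_zero, add_zero]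
  · simp only [CoverPoint.step]
    rw [h, add_assoc, CharTwo.add_self_eq_zero, add_zero]

theorem CoverPoint.step_comm {m : ℕ} {i j : Fin (m + 4)} (h : (j : ℕ) + 1 ≠ i)
    (h' : (i : ℕ) + 1 ≠ j) (p : CoverPoint m) :
    CoverPoint.step i (CoverPoint.step j p) = CoverPoint.step j (CoverPoint.step i p) := by
  ext1
  · simp only [CoverPoint.step]
    exact add_right_comm _ _ _
  · simp only [CoverPoint.step]
    rw [sheetChange_add_single h, sheetChange_add_single h', add_right_comm]

/-- The step `sᵢ` as a permutation of the double cover. -/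
def CoverPoint.stepPerm {m : ℕ} (i : Fin (m + 4)) : Equiv.Perm (CoverPoint m) :=
  Function.Involutive.toPerm (CoverPoint.step i) (CoverPoint.step_step i)

theorem CoverPoint.stepPerm_apply {m : ℕ} (i : Fin (m + 4)) (p : CoverPoint m) :
    CoverPoint.stepPerm i p = CoverPoint.step i p := rfl

theorem CoverPoint.isLiftable_stepPerm (m : ℕ) :
    (universalMatrix (m + 4)).IsLiftable (CoverPoint.stepPerm (m := m)) := by
  intro i j
  simp only [universalMatrix, Matrix.of_apply]
  split_ifs with h1 h2
  · subst h1
    ext1 p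
    simp [CoverPoint.stepPerm_apply, CoverPoint.step_step]
  · simp
  · push Not at h2
    ext1 p
    simp only [pow_two, Equiv.Perm.mul_apply, Equiv.Perm.one_apply, CoverPoint.stepPerm_apply]
    rw [CoverPoint.step_comm h2.2 h2.1, CoverPoint.step_step, CoverPoint.step_step]

/-- The action of the universal group on the double cover. -/
def coverAction (m : ℕ) : UniversalGroup (m + 4) →* Equiv.Perm (CoverPoint m) :=
  (universalMatrix (m + 4)).toCoxeterSystem.lift
    ⟨CoverPoint.stepPerm, CoverPoint.isLiftable_stepPerm m⟩

theorem coverAction_gen {m : ℕ} (i : Fin (m + 4)) (p : CoverPoint m) :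
    coverAction m (gen i) p = CoverPoint.step i p := by
  have h : coverAction m (gen i) = CoverPoint.stepPerm i :=
    (universalMatrix (m + 4)).toCoxeterSystem.lift_apply_simple (CoverPoint.isLiftable_stepPerm m) i
  rw [h]
  rfl

theorem coverAction_gen_mul {m : ℕ} (i : Fin (m + 4)) (w : UniversalGroup (m + 4))
    (p : CoverPoint m) :
    coverAction m (gen i * w) p = CoverPoint.step i (coverAction m w p) := by
  rw [map_mul, Equiv.Perm.mul_apply, coverAction_gen]

/-- The element `(s₀ s₁)²`. -/
def firstDeck (m : ℕ) : UniversalGroup (m + 4) :=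
  gen 0 * (gen 1 * (gen 0 * gen 1))

/-- The element `(s₂ s₃)²`. -/
def secondDeck (m : ℕ) : UniversalGroup (m + 4) :=
  gen 2 * (gen 3 * (gen 2 * gen 3))

theorem coverAction_firstDeck {m : ℕ} (p : CoverPoint m) :
    coverAction m (firstDeck m) p = (p.1, p.2 + 1) := by
  have e : ((1 : Fin (m + 4)) : ℕ) = 1 := rfl
  have hs := CharTwo.add_self_eq_zero (R := ZMod 2)
  simp only [firstDeck, coverAction_gen_mul, coverAction_gen, CoverPoint.step]
  ext1
  · ext k
    simp only [Pi.add_apply]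
    linear_combination hs (Pi.single (M := fun _ => ZMod 2) (0 : Fin (m + 4)) 1 k) +
      hs (Pi.single (M := fun _ => ZMod 2) (1 : Fin (m + 4)) 1 k)
  · have h10 : (0 : Fin (m + 4)) ≠ 1 := by simp
    simp only [sheetChange, e, Fin.val_zero, Pi.add_apply, Pi.single_apply]
    simp [h10]
    linear_combination hs (p.1 0)

theorem coverAction_secondDeck {m : ℕ} (p : CoverPoint m) :
    coverAction m (secondDeck m) p = (p.1, p.2 + 1) := by
  have e2 : ((2 : Fin (m + 4)) : ℕ) = 2 := rfl
  have e3 : ((3 : Fin (m + 4)) : ℕ) = 3 := rfl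
  have hs := CharTwo.add_self_eq_zero (R := ZMod 2)
  simp only [secondDeck, coverAction_gen_mul, coverAction_gen, CoverPoint.step]
  ext1
  · ext k
    simp only [Pi.add_apply]
    linear_combination hs (Pi.single (M := fun _ => ZMod 2) (2 : Fin (m + 4)) 1 k) +
      hs (Pi.single (M := fun _ => ZMod 2) (3 : Fin (m + 4)) 1 k)
  · have h23 : (2 : Fin (m + 4)) ≠ 3 := fun h => by
      have := congrArg Fin.val h
      omega
    simp only [sheetChange, e2, e3, Pi.add_apply, Pi.single_apply]
    simp [h23]
    linear_combination hs (p.1 2)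

theorem gen_mem_faceGroup {n : ℕ} {r : Fin (n + 2)} {j : Fin n} (h : (j : ℕ) + 1 ≠ r) :
    gen j ∈ faceGroup n r :=
  Subgroup.subset_closure ⟨j, h, rfl⟩

/-- Every face group contains an element that interchanges the two sheets. -/
theorem exists_faceGroup_deck {m : ℕ} (r : Fin (m + 4 + 2)) :
    ∃ d ∈ faceGroup (m + 4) r, ∀ p, coverAction m d p = (p.1, p.2 + 1) := by
  have e1 : ((1 : Fin (m + 4)) : ℕ) = 1 := rfl
  have e2 : ((2 : Fin (m + 4)) : ℕ) = 2 := rfl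
  have e3 : ((3 : Fin (m + 4)) : ℕ) = 3 := rfl
  -- The encoded ranks `1` and `2` omit `s₀` and `s₁`, and then `s₂` and `s₃` are available.
  by_cases hr : (r : ℕ) ≤ 2
  · have h2 : gen (2 : Fin (m + 4)) ∈ faceGroup (m + 4) r := gen_mem_faceGroup (by omega)
    have h3 : gen (3 : Fin (m + 4)) ∈ faceGroup (m + 4) r := gen_mem_faceGroup (by omega)
    exact ⟨secondDeck m, mul_mem h2 (mul_mem h3 (mul_mem h2 h3)), coverAction_secondDeck⟩
  · have h0 : gen (0 : Fin (m + 4)) ∈ faceGroup (m + 4) r :=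
      gen_mem_faceGroup (by rw [Fin.val_zero]; omega)
    have h1 : gen (1 : Fin (m + 4)) ∈ faceGroup (m + 4) r := gen_mem_faceGroup (by omega)
    exact ⟨firstDeck m, mul_mem h0 (mul_mem h1 (mul_mem h0 h1)), coverAction_firstDeck⟩

theorem ZMod.eq_or_eq_add_one_of_two (a b : ZMod 2) : a = b ∨ a = b + 1 := by
  revert a b
  decide

theorem coverAction_apply_of_mem_faceGroup {m : ℕ} {r : Fin (m + 4 + 2)}
    {h : UniversalGroup (m + 4)} (hh : h ∈ faceGroup (m + 4) r) {i : Fin (m + 4)}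
    (hi : (i : ℕ) + 1 = r) (p : CoverPoint m) :
    (coverAction m h p).1 i = p.1 i := by
  have hgen : ∀ j : Fin (m + 4), (j : ℕ) + 1 ≠ r → ∀ q : CoverPoint m,
      (CoverPoint.step j q).1 i = q.1 i := by
    intro j hj q
    have : i ≠ j := by
      rintro rfl
      exact hj hi
    simp [CoverPoint.step, this]
  induction hh using Subgroup.closure_induction_left with
  | one => simp
  | mul_left x hx y _ ih =>
    obtain ⟨j, hj, rfl⟩ := hx
    rw [coverAction_gen_mul, hgen j hj, ih]
  | inv_mul_cancel x hx y _ ih =>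
    obtain ⟨j, hj, rfl⟩ := hx
    rw [← eq_inv_of_mul_eq_one_right (gen_mul_self j), coverAction_gen_mul, hgen j hj, ih]

/-- The orbits of the face group of rank `r - 1` on the double cover are cut out by the coordinate
`r - 1` alone (and there is a single orbit for an improper rank). -/
theorem exists_faceGroup_coverAction_eq {m : ℕ} (r : Fin (m + 4 + 2)) (p q : CoverPoint m)
    (hpq : ∀ i : Fin (m + 4), (i : ℕ) + 1 = r → p.1 i = q.1 i) :
    ∃ h ∈ faceGroup (m + 4) r, coverAction m h p = q := by
  induction hk : (Finset.univ.filter fun i => p.1 i ≠ q.1 i).card generalizing p with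
  | zero =>
    have h1 : p.1 = q.1 := by
      ext1 i
      by_contra hne
      rw [Finset.card_eq_zero] at hk
      exact Finset.notMem_empty i (hk ▸ Finset.mem_filter.2 ⟨Finset.mem_univ i, hne⟩)
    rcases ZMod.eq_or_eq_add_one_of_two q.2 p.2 with h2 | h2
    · exact ⟨1, one_mem _, by simpa using Prod.ext h1 h2.symm⟩
    · obtain ⟨d, hd, hd'⟩ := exists_faceGroup_deck r
      exact ⟨d, hd, by rw [hd']; exact Prod.ext h1 h2.symm⟩
  | succ k ih =>
    obtain ⟨i, hi⟩ : (Finset.univ.filter fun i => p.1 i ≠ q.1 i).Nonempty := by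
      rw [← Finset.card_pos, hk]
      exact Nat.succ_pos k
    have hi' : p.1 i ≠ q.1 i := (Finset.mem_filter.1 hi).2
    have hir : (i : ℕ) + 1 ≠ r := fun h => hi' (hpq i h)
    have hsame : ∀ j, j ≠ i → (CoverPoint.step i p).1 j = p.1 j := by
      intro j hj
      simp [CoverPoint.step, hj]
    have hflip : (CoverPoint.step i p).1 i = q.1 i := by
      have := (ZMod.eq_or_eq_add_one_of_two (q.1 i) (p.1 i)).resolve_left hi'.symm
      simp [CoverPoint.step, this]
    obtain ⟨h, hh, hhp⟩ := ih (CoverPoint.step i p)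
      (fun j hj => by
        have : j ≠ i := by
          rintro rfl
          exact hir hj
        rw [hsame j this, hpq j hj])
      (by
        have : (Finset.univ.filter fun j => (CoverPoint.step i p).1 j ≠ q.1 j) =
            (Finset.univ.filter fun j => p.1 j ≠ q.1 j).erase i := by
          ext j
          by_cases hj : j = i
          · subst hj
            simp [hflip]
          · simp [hj, hsame j hj]
        rw [this, Finset.card_erase_of_mem hi, hk, Nat.add_sub_cancel])
    refine ⟨h * gen i, mul_mem hh (gen_mem_faceGroup hir), ?_⟩
    rw [map_mul, Equiv.Perm.mul_apply, coverAction_gen, hhp]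

/-! ### The polytope of a point stabilizer of the cover -/

/-- The stabilizer of the point `(0, 0)` of the double cover. -/
def coverStabilizer (m : ℕ) : Subgroup (UniversalGroup (m + 4)) :=
  (MulAction.stabilizer (Equiv.Perm (CoverPoint m)) (0 : CoverPoint m)).comap (coverAction m)

theorem mem_coverStabilizer {m : ℕ} {w : UniversalGroup (m + 4)} :
    w ∈ coverStabilizer m ↔ coverAction m w 0 = 0 := Iff.rfl

/-- The flag of `{2, …, 2}` that `w` carries the flag `0` to. -/
def coords {m : ℕ} (w : UniversalGroup (m + 4)) : Fin (m + 4) → ZMod 2 :=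
  (coverAction m w 0).1

theorem coords_surjective (m : ℕ) : Function.Surjective (coords (m := m)) := by
  intro x
  obtain ⟨h, -, hh⟩ := exists_faceGroup_coverAction_eq (m := m) 0 0 (x, 0)
    (fun i hi => by simp at hi)
  exact ⟨h, by rw [coords, hh]⟩

theorem coords_gen_mul {m : ℕ} (i : Fin (m + 4)) (w : UniversalGroup (m + 4)) :
    coords (gen i * w) = coords w + Pi.single i 1 := by
  rw [coords, coverAction_gen_mul]
  rfl

theorem coords_firstDeck (m : ℕ) : coords (firstDeck m) = coords 1 := by
  rw [coords, coverAction_firstDeck, coords, map_one, Equiv.Perm.one_apply]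

variable {m : ℕ}

theorem mem_carrier_mk' {r : Fin (m + 4 + 2)} {v w : UniversalGroup (m + 4)} :
    v ∈ (Face.mk' (coverStabilizer m) r w).carrier ↔
      ∀ i : Fin (m + 4), (i : ℕ) + 1 = r → coords v i = coords w i := by
  refine DoubleCoset.mem_doubleCoset.trans ⟨?_, fun hvw => ?_⟩
  · rintro ⟨h, hh, k, hk, rfl⟩ i hi
    rw [coords, map_mul, Equiv.Perm.mul_apply, mem_coverStabilizer.1 hk, map_mul,
      Equiv.Perm.mul_apply, coverAction_apply_of_mem_faceGroup hh hi]
    rfl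
  · obtain ⟨h, hh, hhw⟩ := exists_faceGroup_coverAction_eq r (coverAction m w 0)
      (coverAction m v 0) fun i hi => (hvw i hi).symm
    refine ⟨h, hh, (h * w)⁻¹ * v, ?_, by group⟩
    rw [SetLike.mem_coe, mem_coverStabilizer, map_mul, Equiv.Perm.mul_apply, ← hhw,
      ← Equiv.Perm.mul_apply (coverAction m h), ← map_mul, ← Equiv.Perm.mul_apply, ← map_mul,
      inv_mul_cancel, map_one, Equiv.Perm.one_apply]

theorem mk'_eq_mk'_iff {r : Fin (m + 4 + 2)} {v w : UniversalGroup (m + 4)} :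
    Face.mk' (coverStabilizer m) r v = Face.mk' (coverStabilizer m) r w ↔
      ∀ i : Fin (m + 4), (i : ℕ) + 1 = r → coords v i = coords w i := by
  rw [← mem_carrier_mk']
  exact ⟨fun h => h ▸ Face.mem_mk' r v, fun h => (Face.eq_mk' h).symm⟩

theorem Face.exists_eq_mk' {n : ℕ} {N : Subgroup (UniversalGroup n)} (F : Face N) :
    ∃ w, F = Face.mk' N F.rank w := by
  obtain ⟨w, hw⟩ := F.exists_eq
  exact ⟨w, Face.ext (y := Face.mk' N F.rank w) rfl hw⟩

/-- Any two faces of different ranks are incident. -/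
theorem Face.lt_iff_rank_lt (F G : Face (coverStabilizer m)) : F < G ↔ F.rank < G.rank := by
  refine ⟨Face.rank_lt, fun h => ?_⟩
  obtain ⟨v, hv⟩ := F.exists_eq_mk'
  obtain ⟨w, hw⟩ := G.exists_eq_mk'
  -- Different ranks constrain different coordinates, so that one group element serves both faces.
  obtain ⟨x, hx⟩ := coords_surjective m
    fun i => if (i : ℕ) + 1 = F.rank then coords v i else coords w i
  have hxF : F = Face.mk' _ F.rank x := by
    conv_lhs => rw [hv]
    refine mk'_eq_mk'_iff.2 fun i hi => ?_
    simp only [hx]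
    rw [if_pos hi]
  have hxG : G = Face.mk' _ G.rank x := by
    conv_lhs => rw [hw]
    refine mk'_eq_mk'_iff.2 fun i hi => ?_
    have hne : (i : ℕ) + 1 ≠ F.rank := by
      have : (F.rank : ℕ) < G.rank := h
      omega
    simp only [hx]
    rw [if_neg hne]
  rw [hxF, hxG]
  exact Face.mk'_lt x h

theorem Face.eq_of_rank_improper {F G : Face (coverStabilizer m)} (h : F.rank = G.rank)
    (h' : ∀ i : Fin (m + 4), (i : ℕ) + 1 ≠ F.rank) : F = G := by
  obtain ⟨v, hv⟩ := F.exists_eq_mk'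
  obtain ⟨w, hw⟩ := G.exists_eq_mk'
  rw [hv, hw, ← h]
  exact mk'_eq_mk'_iff.2 fun i hi => absurd hi (h' i)

/-- There are exactly two faces of each proper rank. -/
theorem ncard_setOf_rank_eq (i : Fin (m + 4)) :
    {F : Face (coverStabilizer m) | (F.rank : ℕ) = i + 1}.ncard = 2 := by
  rw [Set.ncard_eq_two]
  refine ⟨Face.mk' _ ⟨i + 1, by omega⟩ 1, Face.mk' _ ⟨i + 1, by omega⟩ (gen i * 1), ?_, ?_⟩
  · rw [Ne, mk'_eq_mk'_iff]
    intro h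
    have := h i rfl
    rw [coords_gen_mul] at this
    simp at this
  · ext F
    simp only [Set.mem_ofPred_eq, Set.mem_insert_iff, Set.mem_singleton_iff]
    constructor
    · intro hF
      obtain ⟨v, hv⟩ := F.exists_eq_mk'
      rw [hv, show F.rank = ⟨i + 1, by omega⟩ from Fin.ext hF, mk'_eq_mk'_iff, mk'_eq_mk'_iff]
      refine (ZMod.eq_or_eq_add_one_of_two (coords v i) (coords 1 i)).imp ?_ ?_
      · intro h j hj
        rwa [show j = i from Fin.ext (Nat.succ_injective hj)]
      · intro h j hj
        rw [show j = i from Fin.ext (Nat.succ_injective hj), coords_gen_mul, h]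
        simp
    · rintro (rfl | rfl) <;> rfl

theorem sparse_coverStabilizer (m : ℕ) : Sparse (coverStabilizer m) where
  exists_least := by
    refine ⟨Face.mk' _ 0 1, fun F => ?_⟩
    rcases (Fin.zero_le F.rank).eq_or_lt with h | h
    · exact (Face.eq_of_rank_improper (F := Face.mk' _ 0 1) h
        fun i => Nat.succ_ne_zero _).le
    · exact ((Face.lt_iff_rank_lt _ _).2 h).le
  exists_greatest := by
    refine ⟨Face.mk' _ (Fin.last _) 1, fun F => ?_⟩
    rcases (Fin.le_last F.rank).eq_or_lt with h | h
    · refine (Face.eq_of_rank_improper (G := Face.mk' _ (Fin.last _) 1) h fun i => ?_).le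
      rw [h, Fin.val_last]
      omega
    · exact ((Face.lt_iff_rank_lt _ _).2 h).le
  flag_ncard Φ := by
    rw [← (AbstractPolytope.injOn_rank_flag Face.lt_iff_rank_lt Φ).ncard_image]
    have : Face.rank '' (Φ : Set (Face (coverStabilizer m))) = Set.univ := by
      refine Set.eq_univ_of_forall fun r => ?_
      obtain ⟨F, hF, hr⟩ := AbstractPolytope.exists_mem_flag_rank_eq Face.lt_iff_rank_lt Φ
        (Face.mk' _ r 1)
      exact ⟨F, hF, hr⟩
    rw [this, Set.ncard_univ, Nat.card_eq_fintype_card, Fintype.card_fin]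
  section_flagConnected F G _ :=
    AbstractPolytope.flagConnected_of_lt_iff_rank_lt
      (ρ := fun H : Set.Icc F G => (H : Face (coverStabilizer m)).rank)
      fun a b => Face.lt_iff_rank_lt (a : Face (coverStabilizer m)) b
  diamond F G _ hr := by
    rw [Face.height_eq, Face.height_eq] at hr
    have hr' : (G.rank : ℕ) = F.rank + 2 := by exact_mod_cast hr
    have hlt := G.rank.2
    rw [← ncard_setOf_rank_eq (m := m) ⟨F.rank, by omega⟩]
    congr 1
    ext H
    simp only [Set.mem_Ioo, Face.lt_iff_rank_lt, Fin.lt_def, Set.mem_ofPred_eq]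
    omega

/-! ### The stabilizer of the base flag -/

/-- The flag of the faces `H_i w N`, `-1 ≤ i ≤ n`; for `w = 1` it is the base flag by
definition. -/
def translateFlag {n : ℕ} (N : Subgroup (UniversalGroup n)) (w : UniversalGroup n) :
    Flag (Face N) :=
  flagOfRanks (Set.range fun r => Face.mk' N r w)
    (by
      rintro _ ⟨r, rfl⟩ _ ⟨t, rfl⟩ _
      exact (le_total r t).imp (Face.mk'_le w) (Face.mk'_le w))
    fun r => ⟨_, ⟨r, rfl⟩, rfl⟩

theorem mem_translateFlag {n : ℕ} {N : Subgroup (UniversalGroup n)} {w : UniversalGroup n}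
    {F : Face N} : F ∈ translateFlag N w ↔ F = Face.mk' N F.rank w := by
  constructor
  · rintro ⟨r, rfl⟩
    rfl
  · intro h
    exact ⟨F.rank, h.symm⟩

theorem isAdj_translateFlag (i : Fin (m + 4)) (w : UniversalGroup (m + 4)) :
    IsAdj i (translateFlag (coverStabilizer m) w)
      (translateFlag (coverStabilizer m) (gen i * w)) := by
  constructor
  · intro h
    have hmem : Face.mk' _ ⟨i + 1, by omega⟩ w ∈ translateFlag (coverStabilizer m) (gen i * w) :=
      h ▸ mem_translateFlag.2 rfl
    have := mk'_eq_mk'_iff.1 (mem_translateFlag.1 hmem) i rfl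
    simp [coords_gen_mul] at this
  · intro F hF
    rw [mem_translateFlag, mem_translateFlag]
    have : Face.mk' (coverStabilizer m) F.rank w =
        Face.mk' (coverStabilizer m) F.rank (gen i * w) := by
      refine mk'_eq_mk'_iff.2 fun j hj => ?_
      have hji : j ≠ i := by
        rintro rfl
        exact hF hj.symm
      simp [coords_gen_mul, hji]
    rw [this]

theorem flagAction_gen_translateFlag (hN : Sparse (coverStabilizer m)) (i : Fin (m + 4))
    (w : UniversalGroup (m + 4)) :
    hN.flagAction (gen i) (translateFlag _ w) = translateFlag _ (gen i * w) := by
  rw [hN.flagAction_gen]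
  exact (hN.eq_adj (isAdj_translateFlag i w)).symm

/-- `(s₀ s₁)²` fixes the base flag, because it moves the base point of the cover only within its
fibre. -/
theorem firstDeck_mem_baseFlagStabilizer (hN : Sparse (coverStabilizer m)) :
    firstDeck m ∈ hN.baseFlagStabilizer := by
  change hN.flagAction (firstDeck m) (translateFlag (coverStabilizer m) 1) =
    translateFlag (coverStabilizer m) 1
  have h : hN.flagAction (firstDeck m) (translateFlag (coverStabilizer m) 1) =
      translateFlag (coverStabilizer m) (firstDeck m) := by
    simp only [firstDeck, map_mul, Equiv.Perm.mul_apply, flagAction_gen_translateFlag, mul_one]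
  rw [h]
  refine flag_eq_of_subset fun F hF => ?_
  rw [mem_translateFlag] at hF ⊢
  rw [hF]
  exact mk'_eq_mk'_iff.2 fun i _ => by rw [coords_firstDeck]

theorem firstDeck_notMem_coverStabilizer (m : ℕ) : firstDeck m ∉ coverStabilizer m := by
  rw [mem_coverStabilizer, coverAction_firstDeck]
  intro h
  have := congrArg Prod.snd h
  simp at this

theorem not_semisparse_coverStabilizer (m : ℕ) : ¬ Semisparse (coverStabilizer m) := by
  rintro ⟨hN, h⟩
  exact firstDeck_notMem_coverStabilizer m (h ▸ firstDeck_mem_baseFlagStabilizer hN)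

end StringCoxeter

theorem mainTheorem1 (n : ℕ) (hn : 3 < n) :
    ∃ N : Subgroup (StringCoxeter.UniversalGroup n),
      StringCoxeter.Sparse N ∧ ¬ StringCoxeter.Semisparse N := by
  obtain ⟨m, rfl⟩ := Nat.exists_eq_add_of_le' (show 4 ≤ n from hn)
  exact ⟨StringCoxeter.coverStabilizer m, StringCoxeter.sparse_coverStabilizer m,
    StringCoxeter.not_semisparse_coverStabilizer m⟩
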